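/- Let $G=(V,A)$ be a finite digraph with $A\subseteq V\times V$, with $|V|=n$ vertices and $|A|=2n-3$ arcs. Call $G$ strongly edge-connected if for all $u,v\in V$ there is a directed path from $u$ to $v$, and minimally strongly edge-connected if in addition no digraph $(V,A')$ with $A'\subset A$ and $|A'|=|A|-1$ is strongly edge-connected. A bi-directed forest is a loopless digraph in which the reverse of every arc is also an arc and whose underlying undirected graph is acyclic; its trees are its connected components (the forest may be empty, and a tree may be a single vertex). For a subgraph $F$ of $G$, let $G\setminus F$ be the graph formed by the arcs of $G$ that are not in $F$, together with their end vertices. Then $G$ is minimally strongly edge-connected if and only if there is a subgraph $F$ of $G$ that is a bi-directed forest such that $G$ is the union (of vertices and of arcs) of $F$ and $G\setminus F$, and (i) $G\setminus F$ is the union of a nonempty family of circuits of size $3$ (directed cycles on three distinct vertices), all of which contain one common arc $a\in A$; (ii) each tree of $F$ contains exactly one vertex of $G\setminus F$. -/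

import Mathlib

namespace Digraph

variable {V : Type*}

/-- The set of arcs of a digraph, as ordered pairs (tail, head). -/
def arcs (G : Digraph V) : Set (V × V) := {e | G.Adj e.1 e.2}

/-- For all vertices `u`, `v` there is a directed path (a finite, possibly empty, sequence of
consecutive arcs) from `u` to `v`. -/
def IsStronglyConnected (G : Digraph V) : Prop :=
  ∀ u v : V, Relation.ReflTransGen G.Adj u v

/-- `G` is strongly connected, and no digraph on the same vertices whose arc set is contained in
that of `G` and has exactly one arc less is strongly connected (finite digraphs). -/
def IsMinimallyStronglyConnected (G : Digraph V) : Prop :=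
  G.IsStronglyConnected ∧
    ∀ G' : Digraph V, G'.arcs ⊆ G.arcs → G'.arcs.ncard + 1 = G.arcs.ncard →
      ¬ G'.IsStronglyConnected

/-- `C` is the arc set of a circuit with `k` arcs (and `k` distinct vertices):
`u 0 → u 1 → ⋯ → u (k - 1) → u 0`; the addition in `Fin k` is modulo `k`. -/
def IsCircuitOfSize (k : ℕ) [NeZero k] (C : Set (V × V)) : Prop :=
  ∃ u : Fin k → V, Function.Injective u ∧ C = Set.range fun i => (u i, u (i + 1))

/-- A subgraph of a digraph `G`: a set of vertices and a set of arcs of `G` between them. -/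
structure SubDigraph (G : Digraph V) where
  verts : Set V
  arcSet : Set (V × V)
  arcSet_subset : arcSet ⊆ G.arcs
  fst_mem : ∀ e ∈ arcSet, e.1 ∈ verts
  snd_mem : ∀ e ∈ arcSet, e.2 ∈ verts

namespace SubDigraph

variable {G : Digraph V}

/-- The undirected graph underlying a subgraph of a digraph (vertices of `V` outside the subgraph
are isolated in it). -/
def underlying (F : SubDigraph G) : SimpleGraph V :=
  SimpleGraph.fromRel fun u v => (u, v) ∈ F.arcSet

/-- A bi-directed forest: without loops, with every arc its reverse is an arc, and the underlying
undirected graph is acyclic. -/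
def IsBidirectedForest (F : SubDigraph G) : Prop :=
  (∀ v, (v, v) ∉ F.arcSet) ∧
    (∀ u v, (u, v) ∈ F.arcSet → (v, u) ∈ F.arcSet) ∧
    F.underlying.IsAcyclic

/-- `T` is the vertex set of a connected component (a tree, if `F` is a forest) of `F`. -/
def IsTree (F : SubDigraph G) (T : Set V) : Prop :=
  ∃ v ∈ F.verts, T = {w | F.underlying.Reachable v w}

/-- The graph `G ∖ F`: the arcs of `G` that are not in `F`, with their end vertices. -/
def compl (F : SubDigraph G) : SubDigraph G where
  verts := {v | ∃ e ∈ G.arcs \ F.arcSet, v = e.1 ∨ v = e.2}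
  arcSet := G.arcs \ F.arcSet
  arcSet_subset := Set.sdiff_subset
  fst_mem := fun e he => ⟨e, he, Or.inl rfl⟩
  snd_mem := fun e he => ⟨e, he, Or.inr rfl⟩

/-- `G` is the union of its subgraphs `F` and `H`. -/
def UnionEq (F H : SubDigraph G) : Prop :=
  F.verts ∪ H.verts = Set.univ ∧ F.arcSet ∪ H.arcSet = G.arcs

/-- `H` is the union of a nonempty family of circuits of size `3`, all containing one common
arc `a`. -/
def ConsistsOfTrianglesSharingArc (H : SubDigraph G) : Prop :=
  ∃ a ∈ G.arcs, ∃ 𝒞 : Set (Set (V × V)), 𝒞.Nonempty ∧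
    (∀ C ∈ 𝒞, IsCircuitOfSize 3 C ∧ a ∈ C) ∧
    H.arcSet = ⋃₀ 𝒞

end SubDigraph

end Digraph

open Relation

/-! Write m for the number of arcs. In a strongly connected digraph, contract a strongly connected
piece `B` that absorbs a set `D` of vertices. Then `B`, an out-branching and an in-branching of the
contraction form a strongly connected spanning subgraph with at most |B| + 2(n - |D| - 1) arcs.
Minimality forces this to be all of `G` (`ncard_arcs_le`). A circuit of length k gives m ≤ 2n - k,
so with m = 2n - 3 every arc lies on a circuit of size two or three. Two triangles with at most one
common vertex would give m ≤ 2n - 4. So any two triangles share an arc, and hence all triangles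
share one arc. As m is odd, some arc has no reverse, so a triangle exists. The symmetric arcs form
`F`: a cycle in `F`, or a tree meeting `G ∖ F` twice, would allow an arc to be bypassed
(`exists_decomposition`). Conversely, a decomposition is strongly connected, and each of its arcs is
the only one leaving some vertex set (`exists_cut_of_decomposition`), so no arc can be dropped. -/

/-! ### Branchings modulo a contraction, and repetition-free paths. -/

/-- If `B` ties every vertex of `D` to a vertex outside `D` (in both directions), then a relation in
which `r` reaches every vertex has at most `|V| - |D| - 1` pairs that, together with `B`, suffice for
`r` to reach every vertex. -/
lemma exists_branching {V : Type*} [Fintype V] (R B : V → V → Prop) (D : Finset V)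
    (hD : ∀ d ∈ D, ∃ w ∉ D, ReflTransGen B d w ∧ ReflTransGen B w d)
    (r : V) (hr : ∀ v, ReflTransGen R r v) :
    ∃ X : Finset (V × V), (∀ e ∈ X, R e.1 e.2) ∧ X.card + D.card + 1 ≤ Fintype.card V ∧
      ∀ v, ReflTransGen (fun a b => B a b ∨ (a, b) ∈ X) r v := by
  classical
  -- The vertex `f v` represents `v` outside `D`. The branching grows on representatives only, so
  -- moving within `B` costs no new pair.
  have hf : ∀ v, ∃ w, w ∉ D ∧ ReflTransGen B v w ∧ ReflTransGen B w v := by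
    intro v
    by_cases hv : v ∈ D
    · exact hD v hv
    · exact ⟨v, hv, .refl, .refl⟩
  choose f hfD hf1 hf2 using hf
  have mono : ∀ {X : Finset (V × V)} {a b : V}, ReflTransGen B a b →
      ReflTransGen (fun a b => B a b ∨ (a, b) ∈ X) a b :=
    fun h => ReflTransGen.mono (fun _ _ => Or.inl) _ _ h
  have grow : ∀ k : ℕ, ∃ (T : Finset V) (X : Finset (V × V)), T ⊆ Dᶜ ∧ f r ∈ T ∧
      (∀ e ∈ X, R e.1 e.2) ∧ X.card + 1 ≤ T.card ∧
      (∀ t ∈ T, ReflTransGen (fun a b => B a b ∨ (a, b) ∈ X) r t) ∧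
      (k + 1 ≤ T.card ∨ ∀ v, f v ∈ T) := by
    intro k
    induction k with
    | zero =>
      refine ⟨{f r}, ∅, ?_, by simp, by simp, by simp, ?_, by simp⟩
      · simpa using hfD r
      · intro t ht
        rw [Finset.mem_singleton.1 ht]
        exact mono (hf1 r)
    | succ k ih =>
      obtain ⟨T, X, hTD, hrT, hX, hc, hreach, h | h⟩ := ih
      swap
      · exact ⟨T, X, hTD, hrT, hX, hc, hreach, Or.inr h⟩
      by_cases hall : ∀ v, f v ∈ T
      · exact ⟨T, X, hTD, hrT, hX, hc, hreach, Or.inr hall⟩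
      push Not at hall
      obtain ⟨v, hv⟩ := hall
      -- An `R`-path from `r` to `v` must leave the set of vertices whose representative is in `T`.
      have : ∃ p q, R p q ∧ f p ∈ T ∧ f q ∉ T := by
        by_contra! hno
        have : ∀ w, ReflTransGen R r w → f w ∈ T := by
          intro w hw
          induction hw with
          | refl => exact hrT
          | tail _ h2 ih => exact hno _ _ h2 ih
        exact hv (this v (hr v))
      obtain ⟨p, q, hpq, hp, hq⟩ := this
      refine ⟨insert (f q) T, insert (p, q) X, ?_, Finset.mem_insert_of_mem hrT, ?_, ?_, ?_, ?_⟩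
      · intro t ht
        rcases Finset.mem_insert.1 ht with rfl | ht
        · simpa using hfD q
        · exact hTD ht
      · intro e he
        rcases Finset.mem_insert.1 he with rfl | he
        · exact hpq
        · exact hX e he
      · rw [Finset.card_insert_of_notMem hq]
        have := Finset.card_insert_le (p, q) X
        omega
      · have hmono : ∀ t ∈ T,
            ReflTransGen (fun a b => B a b ∨ (a, b) ∈ insert (p, q) X) r t := fun t ht =>
          ReflTransGen.mono (fun a b h => h.imp_right Finset.mem_insert_of_mem) _ _ (hreach t ht)
        intro t ht
        rcases Finset.mem_insert.1 ht with rfl | ht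
        · exact (((hmono _ hp).trans (mono (hf2 p))).tail
            (Or.inr (Finset.mem_insert_self _ _))).trans (mono (hf1 q))
        · exact hmono t ht
      · rw [Finset.card_insert_of_notMem hq]
        left; omega
  obtain ⟨T, X, hTD, -, hX, hc, hreach, h⟩ := grow (Fintype.card V)
  have h := h.resolve_left (by have := T.card_le_univ; omega)
  refine ⟨X, hX, ?_, fun v => (hreach _ (h v)).trans (mono (hf2 v))⟩
  have h1 := Finset.card_le_card hTD
  have h2 := D.card_compl_add_card
  omega

/-- A relation on a finite type joining `a` to `b` does so along a sequence without repetitions. -/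
lemma exists_injOn_path {V : Type*} {R : V → V → Prop} {a b : V} (h : ReflTransGen R a b) :
    ∃ (n : ℕ) (p : ℕ → V), p 0 = a ∧ p n = b ∧ (∀ i < n, R (p i) (p (i + 1))) ∧
      ∀ i j, i < j → j ≤ n → p i ≠ p j := by
  classical
  have ex : ∃ (n : ℕ) (p : ℕ → V), p 0 = a ∧ p n = b ∧ ∀ i < n, R (p i) (p (i + 1)) := by
    induction h with
    | refl => exact ⟨0, fun _ => a, rfl, rfl, by simp⟩
    | @tail c d _ hcd ih =>
      obtain ⟨n, p, h0, hn, hp⟩ := ih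
      refine ⟨n + 1, fun i => if i ≤ n then p i else d, by simpa, by simp, fun i hi => ?_⟩
      rcases Nat.lt_succ_iff_lt_or_eq.1 hi with hi | rfl
      · simpa [hi.le, Nat.succ_le_of_lt hi] using hp i hi
      · simpa [hn] using hcd
  obtain ⟨p, h0, hn, hp⟩ := Nat.find_spec ex
  refine ⟨Nat.find ex, p, h0, hn, hp, fun i j hij hj heq => ?_⟩
  -- Cutting out the closed walk between two equal entries would shorten a shortest walk.
  refine Nat.find_min ex (m := Nat.find ex - (j - i)) (by omega)
    ⟨fun k => if k ≤ i then p k else p (k + (j - i)), by simpa, ?_, fun k hk => ?_⟩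
  · dsimp only
    split_ifs with hle
    · have h1 : Nat.find ex = j := by omega
      have h2 : Nat.find ex - (j - i) = i := by omega
      rw [h2, heq, ← h1, hn]
    · rw [Nat.sub_add_cancel (by omega), hn]
  · dsimp only
    rcases lt_trichotomy k i with hki | rfl | hki
    · rw [if_pos hki.le, if_pos (by omega)]
      exact hp k (by omega)
    · rw [if_pos le_rfl, if_neg (by omega), heq, show k + 1 + (j - k) = j + 1 by omega]
      exact hp j (by omega)
    · rw [if_neg (by omega), if_neg (by omega), show k + 1 + (j - i) = k + (j - i) + 1 by omega]
      exact hp _ (by omega)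

/-! ### Bypasses and the arc count in minimally strongly connected digraphs. -/

namespace Digraph

variable {V : Type*}

namespace IsMinimallyStronglyConnected

variable {G : Digraph V}

lemma not_forall_reflTransGen [Finite V] (hG : G.IsMinimallyStronglyConnected) {u v : V}
    (huv : G.Adj u v) {S : V → V → Prop} (hS : ∀ a b, S a b → G.Adj a b ∧ (a, b) ≠ (u, v)) :
    ¬ ∀ a b, ReflTransGen S a b := by
  intro h
  refine hG.2 ⟨fun a b => G.Adj a b ∧ (a, b) ≠ (u, v)⟩ (fun e he => he.1) ?_
    fun a b => ReflTransGen.mono hS _ _ (h a b)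
  have : (⟨fun a b => G.Adj a b ∧ (a, b) ≠ (u, v)⟩ : Digraph V).arcs = G.arcs \ {(u, v)} := by
    ext e
    simp [arcs]
  rw [this]
  exact Set.ncard_sdiff_singleton_add_one (show (u, v) ∈ G.arcs from huv) (Set.toFinite _)

/-- No arc of a minimally strongly connected digraph can be bypassed. -/
lemma not_bypass [Finite V] (hG : G.IsMinimallyStronglyConnected) {u v : V}
    (huv : G.Adj u v) :
    ¬ ReflTransGen (fun a b => G.Adj a b ∧ (a, b) ≠ (u, v)) u v := by
  intro h
  refine hG.not_forall_reflTransGen huv (fun a b h => h) fun a b => ?_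
  have := hG.1 a b
  induction this with
  | refl => exact .refl
  | @tail c d _ hcd ih =>
    by_cases he : (c, d) = (u, v)
    · obtain ⟨rfl, rfl⟩ := Prod.mk.inj he
      exact ih.trans h
    · exact ih.tail ⟨hcd, he⟩

lemma ne_of_adj [Finite V] (hG : G.IsMinimallyStronglyConnected) {u v : V}
    (huv : G.Adj u v) : u ≠ v := by
  rintro rfl
  exact hG.not_bypass huv .refl

lemma not_adj_of_path_two [Finite V] (hG : G.IsMinimallyStronglyConnected) {u w v : V}
    (h1 : G.Adj u w) (h2 : G.Adj w v) : ¬ G.Adj u v := by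
  intro h
  refine hG.not_bypass h ((ReflTransGen.single ⟨h1, ?_⟩).tail ⟨h2, ?_⟩)
  · exact fun e => hG.ne_of_adj h1 (Prod.mk.inj e).1.symm
  · exact fun e => hG.ne_of_adj h2 (Prod.mk.inj e).2

/-- Contracting the `B`-classes of the vertices in `D` bounds the number of arcs. -/
lemma ncard_arcs_le [Fintype V] (hG : G.IsMinimallyStronglyConnected) [Nonempty V]
    (B : Finset (V × V)) (hB : ∀ e ∈ B, G.Adj e.1 e.2) (D : Finset V)
    (hD : ∀ d ∈ D, ∃ w ∉ D, ReflTransGen (fun a b => (a, b) ∈ B) d w ∧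
      ReflTransGen (fun a b => (a, b) ∈ B) w d) :
    G.arcs.ncard + 2 * D.card + 2 ≤ B.card + 2 * Fintype.card V := by
  classical
  obtain ⟨r⟩ := ‹Nonempty V›
  obtain ⟨X, hX, hXc, hXr⟩ := exists_branching G.Adj _ D hD r (hG.1 r)
  -- An in-branching towards `r` is an out-branching of the reversed relations.
  obtain ⟨Y, hY, hYc, hYr⟩ := exists_branching (fun a b => G.Adj b a) (fun a b => (b, a) ∈ B) D
    (fun d hd => by
      obtain ⟨w, hw, h1, h2⟩ := hD d hd
      exact ⟨w, hw, h2.swap, h1.swap⟩) r (fun v => (hG.1 v r).swap)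
  let Z := B ∪ X ∪ Y.image Prod.swap
  have hZ : G.arcs ⊆ Z := by
    rintro ⟨u, v⟩ huv
    by_contra hZ
    refine hG.not_forall_reflTransGen huv (S := fun a b => (a, b) ∈ Z) ?_ ?_
    · intro a b hab
      refine ⟨?_, fun h => hZ (h ▸ hab)⟩
      simp only [Z, Finset.mem_union, Finset.mem_image, Prod.exists] at hab
      rcases hab with (hab | hab) | ⟨c, d, hab, h⟩
      · exact hB _ hab
      · exact hX _ hab
      · obtain ⟨rfl, rfl⟩ := Prod.mk.inj h
        exact hY _ hab
    · intro a b
      refine ReflTransGen.trans (b := r) ?_ ?_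
      · refine ReflTransGen.mono ?_ _ _ (hYr a).swap
        rintro c d (h | h)
        · simp [Z, h]
        · simp only [Z, Finset.mem_union, Finset.mem_image]
          exact Or.inr ⟨_, h, rfl⟩
      · refine ReflTransGen.mono ?_ _ _ (hXr b)
        rintro c d (h | h) <;> simp [Z, h]
  have h1 := Set.ncard_le_ncard hZ (Set.toFinite _)
  rw [Set.ncard_coe_finset] at h1
  have h2 : Z.card ≤ B.card + X.card + Y.card :=
    (Finset.card_union_le _ _).trans
      (add_le_add (Finset.card_union_le _ _) Finset.card_image_le)
  omega

/-- With `2 * n - 3` arcs, every arc lies on a circuit of size two or three. -/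
lemma adj_symm_or_triangle [Fintype V] (hG : G.IsMinimallyStronglyConnected)
    (hm : 2 * Fintype.card V ≤ G.arcs.ncard + 3) {u v : V} (huv : G.Adj u v) :
    G.Adj v u ∨ ∃ w, G.Adj v w ∧ G.Adj w u := by
  classical
  have : Nonempty V := ⟨u⟩
  obtain ⟨n, p, h0, hn, hp, hinj⟩ := exists_injOn_path (hG.1 v u)
  -- The circuit formed by `(u, v)` and the path back has `n + 1` arcs, and contracting it to `u`
  -- absorbs the other `n` vertices. The bound becomes m ≤ 2|V| - n - 1, so `n ≤ 2`.
  let B : Finset (V × V) := insert (u, v) ((Finset.range n).image fun i => (p i, p (i + 1)))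
  have hpB : ∀ i < n, (p i, p (i + 1)) ∈ B := fun i hi =>
    Finset.mem_insert_of_mem (Finset.mem_image_of_mem _ (Finset.mem_range.2 hi))
  have hreach : ∀ i j, i ≤ j → j ≤ n → ReflTransGen (fun a b => (a, b) ∈ B) (p i) (p j) := by
    intro i j hij
    induction j, hij using Nat.le_induction with
    | base => exact fun _ => .refl
    | succ j hij ih => exact fun hj => (ih (by omega)).tail (hpB j (by omega))
  have key := hG.ncard_arcs_le B (by
    intro e he
    simp only [B, Finset.mem_insert, Finset.mem_image, Finset.mem_range] at he
    rcases he with rfl | ⟨i, hi, rfl⟩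
    · exact huv
    · exact hp i hi) ((Finset.range n).image p) (by
    intro d hd
    simp only [Finset.mem_image, Finset.mem_range] at hd
    obtain ⟨i, hi, rfl⟩ := hd
    refine ⟨u, ?_, hn ▸ hreach i n hi.le le_rfl, ?_⟩
    · simp only [Finset.mem_image, Finset.mem_range, not_exists, not_and]
      exact fun j hj => hn ▸ hinj j n hj le_rfl
    · exact ReflTransGen.head (b := p 0) (by simp [B, h0]) (hreach 0 i (by omega) hi.le))
  have hc : ((Finset.range n).image p).card = n := by
    rw [Finset.card_image_of_injOn, Finset.card_range]
    intro i hi j hj hij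
    simp only [Finset.coe_range, Set.mem_Iio] at hi hj
    by_contra hne
    rcases lt_or_gt_of_ne hne with h | h
    · exact hinj i j h hj.le hij
    · exact hinj j i h hi.le hij.symm
  have hBc : B.card ≤ n + 1 :=
    (Finset.card_insert_le _ _).trans (by
      simpa using Finset.card_image_le (s := Finset.range n) (f := fun i => (p i, p (i + 1))))
  have hne := hG.ne_of_adj huv
  have h2 : n ≤ 2 := by omega
  interval_cases n
  · exact absurd (h0.symm.trans hn).symm hne
  · have := hp 0 (by simp)
    rw [h0, hn] at this
    exact Or.inl this
  · have h1 := hp 0 (by simp)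
    have h2 := hp 1 (by simp)
    rw [h0] at h1
    rw [hn] at h2
    exact Or.inr ⟨_, h1, h2⟩

/-- With `2 * n - 3` arcs, two triangles that meet at most in their first vertices do not exist. -/
lemma false_of_two_triangles [Fintype V] (hG : G.IsMinimallyStronglyConnected)
    (hm : 2 * Fintype.card V ≤ G.arcs.ncard + 3) {s a b t c d : V}
    (h1 : G.Adj s a) (h2 : G.Adj a b) (h3 : G.Adj b s)
    (h4 : G.Adj t c) (h5 : G.Adj c d) (h6 : G.Adj d t)
    (hac : a ≠ c) (had : a ≠ d) (hbc : b ≠ c) (hbd : b ≠ d)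
    (hsc : s ≠ c) (hsd : s ≠ d) (hta : t ≠ a) (htb : t ≠ b) : False := by
  classical
  have : Nonempty V := ⟨s⟩
  have n1 := hG.ne_of_adj h1
  have n2 := hG.ne_of_adj h2
  have n3 := hG.ne_of_adj h3
  have n4 := hG.ne_of_adj h4
  have n5 := hG.ne_of_adj h5
  have n6 := hG.ne_of_adj h6
  let B : Finset (V × V) := {(s, a), (a, b), (b, s), (t, c), (c, d), (d, t)}
  have single : ∀ {x y : V}, (x, y) ∈ B → ReflTransGen (fun x y => (x, y) ∈ B) x y :=
    fun h => ReflTransGen.single h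
  have e1 := single (x := s) (y := a) (by simp [B])
  have e2 := single (x := a) (y := b) (by simp [B])
  have e3 := single (x := b) (y := s) (by simp [B])
  have e4 := single (x := t) (y := c) (by simp [B])
  have e5 := single (x := c) (y := d) (by simp [B])
  have e6 := single (x := d) (y := t) (by simp [B])
  have hsD : s ∉ ({a, b, c, d} : Finset V) := by simp [n1, n3.symm, hsc, hsd]
  have htD : t ∉ ({a, b, c, d} : Finset V) := by simp [hta, htb, n4, n6.symm]
  -- Six arcs absorb four vertices, which gives m ≤ 2|V| - 4. The case `s = t` is allowed.
  have key := hG.ncard_arcs_le B (by simp [B, *]) {a, b, c, d} (by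
    intro x hx
    simp only [Finset.mem_insert, Finset.mem_singleton] at hx
    rcases hx with rfl | rfl | rfl | rfl
    · exact ⟨s, hsD, e2.trans e3, e1⟩
    · exact ⟨s, hsD, e3, e1.trans e2⟩
    · exact ⟨t, htD, e5.trans e6, e4⟩
    · exact ⟨t, htD, e6, e4.trans e5⟩)
  have hDc : ({a, b, c, d} : Finset V).card = 4 := by
    simp [Finset.card_insert_of_notMem, *]
  have hBc : B.card ≤ 6 := Finset.card_le_six
  omega

end IsMinimallyStronglyConnected

end Digraph

/-! ### The common arc of all triangles. -/

namespace Digraph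

variable {V : Type*} {G : Digraph V}

namespace IsMinimallyStronglyConnected

/-- With `2 * n - 3` arcs, any two triangles share an arc. -/
lemma triangles_share_arc [Fintype V] (hG : G.IsMinimallyStronglyConnected)
    (hm : 2 * Fintype.card V ≤ G.arcs.ncard + 3) {x y z p q r : V}
    (h1 : G.Adj x y) (h2 : G.Adj y z) (h3 : G.Adj z x)
    (h4 : G.Adj p q) (h5 : G.Adj q r) (h6 : G.Adj r p) :
    ((x = p ∧ y = q) ∨ (x = q ∧ y = r) ∨ (x = r ∧ y = p)) ∨
    ((y = p ∧ z = q) ∨ (y = q ∧ z = r) ∨ (y = r ∧ z = p)) ∨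
    ((z = p ∧ x = q) ∨ (z = q ∧ x = r) ∨ (z = r ∧ x = p)) := by
  have n1 := hG.not_adj_of_path_two h1 h2
  have n2 := hG.not_adj_of_path_two h2 h3
  have n3 := hG.not_adj_of_path_two h3 h1
  have e1 := hG.ne_of_adj h1
  have e2 := hG.ne_of_adj h2
  have e3 := hG.ne_of_adj h3
  have e4 := hG.ne_of_adj h4
  have e5 := hG.ne_of_adj h5
  have e6 := hG.ne_of_adj h6
  by_contra! hno
  obtain ⟨⟨a1, a2, a3⟩, ⟨b1, b2, b3⟩, c1, c2, c3⟩ := hno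
  have flip : ∀ {a b c d : V}, ¬ G.Adj a b → G.Adj c d → a = c → b ≠ d := by
    rintro a b c d h h' rfl rfl
    exact h h'
  -- By `n1`, `n2`, `n3` no triangle arc has a reverse, so two triangles with two common vertices
  -- would share the arc between them. Hence one common vertex excludes any other.
  by_cases hx : x = p ∨ x = q ∨ x = r
  · have hy : y ≠ p ∧ y ≠ q ∧ y ≠ r := by
      refine ⟨?_, ?_, ?_⟩ <;> rintro rfl <;> grind
    have hz : z ≠ p ∧ z ≠ q ∧ z ≠ r := by
      refine ⟨?_, ?_, ?_⟩ <;> rintro rfl <;> grind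
    rcases hx with rfl | rfl | rfl
    · exact hG.false_of_two_triangles hm h1 h2 h3 h4 h5 h6 hy.2.1 hy.2.2 hz.2.1 hz.2.2
        e4 e6.symm e1 e3.symm
    · exact hG.false_of_two_triangles hm h1 h2 h3 h5 h6 h4 hy.2.2 hy.1 hz.2.2 hz.1
        e5 e4.symm e1 e3.symm
    · exact hG.false_of_two_triangles hm h1 h2 h3 h6 h4 h5 hy.1 hy.2.1 hz.1 hz.2.1
        e6 e5.symm e1 e3.symm
  push Not at hx
  by_cases hy : y = p ∨ y = q ∨ y = r
  · have hz : z ≠ p ∧ z ≠ q ∧ z ≠ r := by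
      refine ⟨?_, ?_, ?_⟩ <;> rintro rfl <;> grind
    rcases hy with rfl | rfl | rfl
    · exact hG.false_of_two_triangles hm h2 h3 h1 h4 h5 h6 hz.2.1 hz.2.2 hx.2.1 hx.2.2
        e4 e6.symm e2 e1.symm
    · exact hG.false_of_two_triangles hm h2 h3 h1 h5 h6 h4 hz.2.2 hz.1 hx.2.2 hx.1
        e5 e4.symm e2 e1.symm
    · exact hG.false_of_two_triangles hm h2 h3 h1 h6 h4 h5 hz.1 hz.2.1 hx.1 hx.2.1
        e6 e5.symm e2 e1.symm
  push Not at hy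
  by_cases hz : z = p
  · subst hz
    exact hG.false_of_two_triangles hm h3 h1 h2 h4 h5 h6 hx.2.1 hx.2.2 hy.2.1 hy.2.2
      e4 e6.symm e3 e2.symm
  by_cases hz' : z = q
  · subst hz'
    exact hG.false_of_two_triangles hm h3 h1 h2 h5 h6 h4 hx.2.2 hx.1 hy.2.2 hy.1
      e5 e4.symm e3 e2.symm
  -- This covers both `z = r` and disjoint triangles.
  · exact hG.false_of_two_triangles hm h3 h1 h2 h6 h4 h5 hx.1 hx.2.1 hy.1 hy.2.1
      hz hz' (Ne.symm hx.2.2) (Ne.symm hy.2.2)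

/-- A triangle that meets both given triangles in arcs but avoids the arc from `x` to `y` would
contain `z` and `w`. It would then have either four vertices or two arcs leaving `y` or entering
`x`. -/
lemma triangle_mem_of_two [Fintype V] (hG : G.IsMinimallyStronglyConnected)
    (hm : 2 * Fintype.card V ≤ G.arcs.ncard + 3) {x y z w : V} (hzw : w ≠ z)
    (h1 : G.Adj x y) (h2 : G.Adj y z) (h3 : G.Adj z x) (h2' : G.Adj y w) (h3' : G.Adj w x)
    (p q r : V) (h4 : G.Adj p q) (h5 : G.Adj q r) (h6 : G.Adj r p) :
    (x = p ∧ y = q) ∨ (x = q ∧ y = r) ∨ (x = r ∧ y = p) := by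
  have s1 := hG.triangles_share_arc hm h1 h2 h3 h4 h5 h6
  have s2 := hG.triangles_share_arc hm h1 h2' h3' h4 h5 h6
  have e1 := hG.ne_of_adj h1
  have e2 := hG.ne_of_adj h2
  have e3 := hG.ne_of_adj h3
  have e2' := hG.ne_of_adj h2'
  have e3' := hG.ne_of_adj h3'
  have e4 := hG.ne_of_adj h4
  have e5 := hG.ne_of_adj h5
  have e6 := hG.ne_of_adj h6
  clear hG hm h1 h2 h3 h2' h3' h4 h5 h6
  rcases s1 with s1 | s1
  · exact s1
  rcases s2 with s2 | s2
  · exact s2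
  grind

/-- With `2 * n - 3` arcs, all triangles have an arc in common. -/
lemma exists_common_arc [Fintype V] (hG : G.IsMinimallyStronglyConnected)
    (hm : 2 * Fintype.card V ≤ G.arcs.ncard + 3) {x₀ y₀ z₀ : V}
    (h1 : G.Adj x₀ y₀) (h2 : G.Adj y₀ z₀) (h3 : G.Adj z₀ x₀) :
    ∃ x y, G.Adj x y ∧ ∀ p q r, G.Adj p q → G.Adj q r → G.Adj r p →
      (x = p ∧ y = q) ∨ (x = q ∧ y = r) ∨ (x = r ∧ y = p) := by
  by_cases c1 : ∃ w, w ≠ z₀ ∧ G.Adj y₀ w ∧ G.Adj w x₀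
  · obtain ⟨w, hw, a, b⟩ := c1
    exact ⟨x₀, y₀, h1, hG.triangle_mem_of_two hm hw h1 h2 h3 a b⟩
  by_cases c2 : ∃ w, w ≠ x₀ ∧ G.Adj z₀ w ∧ G.Adj w y₀
  · obtain ⟨w, hw, a, b⟩ := c2
    exact ⟨y₀, z₀, h2, hG.triangle_mem_of_two hm hw h2 h3 h1 a b⟩
  by_cases c3 : ∃ w, w ≠ y₀ ∧ G.Adj x₀ w ∧ G.Adj w z₀
  · obtain ⟨w, hw, a, b⟩ := c3
    exact ⟨z₀, x₀, h3, hG.triangle_mem_of_two hm hw h3 h1 h2 a b⟩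
  -- No arc of this triangle lies on a second one, so it is the only triangle and any of its arcs
  -- will do.
  push Not at c1 c2 c3
  refine ⟨x₀, y₀, h1, fun p q r h4 h5 h6 => ?_⟩
  rcases hG.triangles_share_arc hm h1 h2 h3 h4 h5 h6 with h | h | h
  · exact h
  · rcases h with ⟨rfl, rfl⟩ | ⟨rfl, rfl⟩ | ⟨rfl, rfl⟩ <;> grind
  · rcases h with ⟨rfl, rfl⟩ | ⟨rfl, rfl⟩ | ⟨rfl, rfl⟩ <;> grind

/-- With an odd number of arcs, some arc has no reverse. -/
lemma exists_adj_not_symm [Finite V] (hG : G.IsMinimallyStronglyConnected)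
    (hodd : Odd G.arcs.ncard) : ∃ u v, G.Adj u v ∧ ¬ G.Adj v u := by
  classical
  by_contra! h
  have hfin : G.arcs.Finite := Set.toFinite _
  -- If all arcs had reverses, reversal would be a fixed-point-free involution on the arcs, making
  -- their number even.
  have := Finset.sum_involution (s := hfin.toFinset) (f := fun _ => (1 : ZMod 2))
    (fun e _ => e.swap) (fun _ _ => by decide)
    (fun e he _ heq => hG.ne_of_adj (show G.Adj e.1 e.2 by simpa [arcs] using he)
      (congrArg Prod.fst heq).symm)
    (fun e he => by
      have he : G.Adj e.1 e.2 := by simpa [arcs] using he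
      simpa [arcs] using h _ _ he)
    (fun e _ => Prod.swap_swap e)
  rw [Finset.sum_const, nsmul_one, ← Set.ncard_eq_toFinset_card _ hfin,
    ZMod.natCast_eq_zero_iff_even] at this
  exact (Nat.not_even_iff_odd.2 hodd) this

end IsMinimallyStronglyConnected

lemma IsCircuitOfSize.eq_of_mem {C : Set (V × V)} (hC : IsCircuitOfSize 3 C) {x y : V}
    (h : (x, y) ∈ C) : ∃ z, x ≠ y ∧ y ≠ z ∧ z ≠ x ∧ C = {(x, y), (y, z), (z, x)} := by
  obtain ⟨u, hu, rfl⟩ := hC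
  obtain ⟨i, hi⟩ := h
  obtain ⟨rfl, rfl⟩ := Prod.mk.inj hi
  clear hi
  refine ⟨u (i + 2), hu.ne (by revert i; decide), hu.ne (by revert i; decide),
    hu.ne (by revert i; decide), ?_⟩
  ext e
  simp only [Set.mem_range, Fin.exists_fin_succ, Set.mem_insert_iff, Set.mem_singleton_iff]
  fin_cases i <;> simp [eq_comm] <;> tauto

lemma isCircuitOfSize_three {x y z : V} (h1 : x ≠ y) (h2 : y ≠ z) (h3 : z ≠ x) :
    IsCircuitOfSize 3 {(x, y), (y, z), (z, x)} := by
  refine ⟨![x, y, z], ?_, ?_⟩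
  · intro i j
    fin_cases i <;> fin_cases j <;> simp [h1, h2, h3, h1.symm, h2.symm, h3.symm]
  · ext e
    simp [Fin.exists_fin_succ, eq_comm]

end Digraph

/-! ### The decomposition given by the symmetric arcs. -/

namespace Digraph

variable {V : Type*} {G : Digraph V}

namespace SubDigraph

lemma mem_verts_of_underlying_adj {F : SubDigraph G} {u v : V} (h : F.underlying.Adj u v) :
    u ∈ F.verts := by
  rcases ((SimpleGraph.fromRel_adj _ _ _).1 h).2 with h | h
  · exact F.fst_mem _ h
  · exact F.snd_mem _ h

namespace IsBidirectedForest

lemma underlying_adj_iff {F : SubDigraph G} (hF : F.IsBidirectedForest) {u v : V} :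
    F.underlying.Adj u v ↔ (u, v) ∈ F.arcSet := by
  rw [underlying, SimpleGraph.fromRel_adj]
  refine ⟨fun h => h.2.elim id (hF.2.1 _ _), fun h => ⟨?_, Or.inl h⟩⟩
  rintro rfl
  exact hF.1 _ h

lemma reflTransGen_of_reachable {F : SubDigraph G} (hF : F.IsBidirectedForest) {u v : V}
    (h : F.underlying.Reachable u v) : ReflTransGen G.Adj u v :=
  ReflTransGen.mono (fun _ _ h => F.arcSet_subset (hF.underlying_adj_iff.1 h)) _ _
    ((SimpleGraph.reachable_iff_reflTransGen _ _).1 h)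

end IsBidirectedForest

/-- The subgraph formed by the arcs whose reverse is an arc. -/
def symmPart (G : Digraph V) : SubDigraph G where
  verts := Set.univ
  arcSet := {e | G.Adj e.1 e.2 ∧ G.Adj e.2 e.1}
  arcSet_subset := fun _ h => h.1
  fst_mem := fun _ _ => Set.mem_univ _
  snd_mem := fun _ _ => Set.mem_univ _

lemma mem_compl_symmPart {u v : V} :
    (u, v) ∈ (symmPart G).compl.arcSet ↔ G.Adj u v ∧ ¬ G.Adj v u := by
  simp only [compl, symmPart, arcs, Set.mem_sdiff, Set.mem_ofPred_eq]
  tauto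

end SubDigraph

open SubDigraph

namespace IsMinimallyStronglyConnected

/-- Every edge is a bridge: an undirected detour consists of symmetric arcs, so it is also a
directed bypass. -/
lemma isBidirectedForest_symmPart [Finite V] (hG : G.IsMinimallyStronglyConnected) :
    (symmPart G).IsBidirectedForest := by
  refine ⟨fun v h => hG.ne_of_adj h.1 rfl, fun u v h => h.symm, ?_⟩
  rw [SimpleGraph.isAcyclic_iff_forall_adj_isBridge]
  intro u v huv
  have huv' : G.Adj u v := by
    rcases ((SimpleGraph.fromRel_adj _ _ _).1 huv).2 with h | h
    exacts [h.1, h.2]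
  rw [SimpleGraph.isBridge_iff, SimpleGraph.reachable_iff_reflTransGen]
  intro h
  refine hG.not_bypass huv' (ReflTransGen.mono ?_ _ _ h)
  intro a b hab
  simp only [SimpleGraph.deleteEdges_adj, Set.mem_singleton_iff] at hab
  refine ⟨?_, ?_⟩
  · rcases ((SimpleGraph.fromRel_adj _ _ _).1 hab.1).2 with h | h
    exacts [h.1, h.2]
  · rintro e
    obtain ⟨rfl, rfl⟩ := Prod.mk.inj e
    simp_all

/-- With `2 * n - 3` arcs, the symmetric arcs form the forest of the decomposition. -/
lemma exists_decomposition [Fintype V] (hG : G.IsMinimallyStronglyConnected)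
    (hm : G.arcs.ncard + 3 = 2 * Fintype.card V) :
    (symmPart G).IsBidirectedForest ∧
      (symmPart G).UnionEq (symmPart G).compl ∧
      (symmPart G).compl.ConsistsOfTrianglesSharingArc ∧
      ∀ T : Set V, (symmPart G).IsTree T → ∃! w : V, w ∈ T ∧ w ∈ (symmPart G).compl.verts := by
  have hF := hG.isBidirectedForest_symmPart
  obtain ⟨x₀, y₀, hxy₀, hyx₀⟩ := hG.exists_adj_not_symm (by rw [Nat.odd_iff]; omega)
  obtain ⟨z₀, hyz₀, hzx₀⟩ := (hG.adj_symm_or_triangle hm.ge hxy₀).resolve_left hyx₀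
  obtain ⟨x, y, hxy, hcommon⟩ := hG.exists_common_arc hm.ge hxy₀ hyz₀ hzx₀
  have tri : ∀ {u v w}, G.Adj u v → G.Adj v w → G.Adj w u → (u, v) ∈ (symmPart G).compl.arcSet :=
    fun h1 h2 h3 => mem_compl_symmPart.2 ⟨h1, hG.not_adj_of_path_two h2 h3⟩
  let S : V → V → Prop := fun a b => (a, b) ∈ (symmPart G).compl.arcSet
  have htriS : ∀ {u v w}, G.Adj u v → G.Adj v w → G.Adj w u → S u v ∧ S v w ∧ S w u :=
    fun h1 h2 h3 => ⟨tri h1 h2 h3, tri h2 h3 h1, tri h3 h1 h2⟩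
  have hreach : ∀ p ∈ (symmPart G).compl.verts, ReflTransGen S p x ∧ ReflTransGen S x p := by
    have aux : ∀ {u v w}, G.Adj u v → G.Adj v w → G.Adj w u →
        ReflTransGen S u x ∧ ReflTransGen S x u := by
      intro u v w h1 h2 h3
      obtain ⟨s1, s2, s3⟩ := htriS h1 h2 h3
      rcases hcommon u v w h1 h2 h3 with ⟨rfl, -⟩ | ⟨rfl, -⟩ | ⟨rfl, -⟩
      · exact ⟨.refl, .refl⟩
      · exact ⟨.single s1, .tail (.single s2) s3⟩
      · exact ⟨.tail (.single s1) s2, .single s3⟩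
    rintro p ⟨⟨u, v⟩, he, hp⟩
    obtain ⟨huv, hvu⟩ := mem_compl_symmPart.1 he
    obtain ⟨w, hvw, hwu⟩ := (hG.adj_symm_or_triangle hm.ge huv).resolve_left hvu
    rcases hp with rfl | rfl
    · exact aux huv hvw hwu
    · exact aux hvw hwu huv
  refine ⟨hF, ⟨by simp [symmPart], ?_⟩, ⟨(x, y), hxy,
    {C | IsCircuitOfSize 3 C ∧ C ⊆ G.arcs}, ?_, ?_, ?_⟩, ?_⟩
  · exact Set.union_sdiff_cancel (symmPart G).arcSet_subset
  · refine ⟨_, isCircuitOfSize_three (hG.ne_of_adj hxy₀) (hG.ne_of_adj hyz₀)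
      (hG.ne_of_adj hzx₀), ?_⟩
    rintro e (rfl | rfl | rfl)
    exacts [hxy₀, hyz₀, hzx₀]
  · rintro C ⟨hC, hCG⟩
    refine ⟨hC, ?_⟩
    obtain ⟨u, hu, rfl⟩ := id hC
    obtain ⟨w, -, -, -, hC'⟩ := hC.eq_of_mem (x := u 0) (y := u 1) ⟨0, rfl⟩
    rw [hC'] at hCG ⊢
    have h := hcommon (u 0) (u 1) w (hCG (a := (u 0, u 1)) (by simp))
      (hCG (a := (u 1, w)) (by simp)) (hCG (a := (w, u 0)) (by simp))
    simpa using h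
  · ext ⟨u, v⟩
    constructor
    · intro he
      obtain ⟨huv, hvu⟩ := mem_compl_symmPart.1 he
      obtain ⟨w, hvw, hwu⟩ := (hG.adj_symm_or_triangle hm.ge huv).resolve_left hvu
      refine ⟨{(u, v), (v, w), (w, u)}, ⟨isCircuitOfSize_three (hG.ne_of_adj huv)
        (hG.ne_of_adj hvw) (hG.ne_of_adj hwu), ?_⟩, by simp⟩
      rintro e (rfl | rfl | rfl)
      exacts [huv, hvw, hwu]
    · rintro ⟨C, ⟨hC, hCG⟩, he⟩
      obtain ⟨w, -, -, -, rfl⟩ := hC.eq_of_mem he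
      exact tri (w := w) (hCG (a := (u, v)) (by simp)) (hCG (a := (v, w)) (by simp))
        (hCG (a := (w, u)) (by simp))
  · rintro T ⟨v, -, rfl⟩
    apply existsUnique_of_exists_of_unique
    · by_contra! hno
      -- If the tree misses `G ∖ F`, every arc leaving one of its vertices is symmetric. So the tree
      -- is closed under arcs and contains all vertices, including `x₀`.
      have hclosed : ∀ w, ReflTransGen G.Adj v w → (symmPart G).underlying.Reachable v w := by
        intro w hw
        induction hw with
        | refl => exact .rfl
        | @tail c d _ hcd ih =>
          have hdc : G.Adj d c := by
            by_contra h
            exact hno c ih ⟨(c, d), mem_compl_symmPart.2 ⟨hcd, h⟩, Or.inl rfl⟩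
          exact ih.trans (hF.underlying_adj_iff.2 ⟨hcd, hdc⟩).reachable
      exact hno x₀ (hclosed _ (hG.1 _ _))
        ⟨(x₀, y₀), mem_compl_symmPart.2 ⟨hxy₀, hyx₀⟩, Or.inl rfl⟩
    · rintro p q ⟨hp, hpH⟩ ⟨hq, hqH⟩
      by_contra hpq
      obtain ⟨n, t, h0, hn, ht, hinj⟩ := exists_injOn_path
        ((SimpleGraph.reachable_iff_reflTransGen _ _).1 (hp.symm.trans hq))
      have hn0 : 0 < n := by
        rcases Nat.eq_zero_or_pos n with rfl | h
        · exact absurd (h0.symm.trans hn) hpq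
        · exact h
      -- The first arc of the forest path from `p` to `q` is bypassed: go from `p` to `q` by
      -- non-symmetric arcs through the hub `x`, then back along the reversed path to `t 1`.
      have ht' : ∀ i < n, G.Adj (t i) (t (i + 1)) ∧ G.Adj (t (i + 1)) (t i) := fun i hi =>
        hF.underlying_adj_iff.1 (ht i hi)
      refine hG.not_bypass (ht' 0 hn0).1 ?_
      have hback : ∀ j, 1 ≤ j → j ≤ n →
          ReflTransGen (fun a b => G.Adj a b ∧ (a, b) ≠ (t 0, t (0 + 1))) (t j) (t (0 + 1)) := by
        intro j hj
        induction j, hj using Nat.le_induction with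
        | base => exact fun _ => .refl
        | succ j hj ih =>
          refine fun hj' => .head ⟨(ht' j (by omega)).2, fun e => ?_⟩ (ih (by omega))
          exact hinj 0 (j + 1) (by omega) hj' (Prod.mk.inj e).1.symm
      refine ReflTransGen.trans ?_ (hback n hn0 le_rfl)
      rw [h0, hn]
      refine ReflTransGen.mono (fun a b hab => ?_) _ _
        ((hreach p hpH).1.trans (hreach q hqH).2)
      obtain ⟨h1, h2⟩ := mem_compl_symmPart.1 hab
      refine ⟨h1, fun e => h2 ?_⟩
      obtain ⟨rfl, rfl⟩ := Prod.mk.inj e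
      exact h0 ▸ (ht' 0 hn0).2

end IsMinimallyStronglyConnected

/-! ### From a decomposition back to minimal strong connectivity. -/

/-- The trees of a decomposition: two vertices of `G ∖ F` in the same tree are equal. -/
lemma SubDigraph.eq_of_reachable {F : SubDigraph G}
    (hT : ∀ T : Set V, F.IsTree T → ∃! w : V, w ∈ T ∧ w ∈ F.compl.verts)
    {p q : V} (hp : p ∈ F.compl.verts) (hq : q ∈ F.compl.verts)
    (h : F.underlying.Reachable p q) : p = q := by
  -- A vertex of `G ∖ F` need not belong to `F`. Only a nontrivial path ensures that `p` lies in a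
  -- tree.
  rcases ((SimpleGraph.reachable_iff_reflTransGen _ _).1 h).cases_head with h' | ⟨c, hc, -⟩
  · exact h'
  · exact (hT _ ⟨p, mem_verts_of_underlying_adj hc, rfl⟩).unique ⟨.rfl, hp⟩ ⟨h, hq⟩

/-- A decomposition into a forest and triangles sharing an arc is strongly connected. -/
lemma isStronglyConnected_of_decomposition {F : SubDigraph G} (hF : F.IsBidirectedForest)
    (hU : F.UnionEq F.compl) (hC : F.compl.ConsistsOfTrianglesSharingArc)
    (hT : ∀ T : Set V, F.IsTree T → ∃! w : V, w ∈ T ∧ w ∈ F.compl.verts) :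
    G.IsStronglyConnected := by
  obtain ⟨⟨x, y⟩, -, 𝒞, -, h𝒞, hH⟩ := hC
  have hub : ∀ p ∈ F.compl.verts, ReflTransGen G.Adj p x ∧ ReflTransGen G.Adj x p := by
    rintro p ⟨e, he, hp⟩
    obtain ⟨C, hC, heC⟩ : e ∈ ⋃₀ 𝒞 := hH ▸ he
    obtain ⟨z, -, -, -, hCz⟩ := (h𝒞 C hC).1.eq_of_mem (h𝒞 C hC).2
    have hsub : C ⊆ G.arcs := fun e he => F.compl.arcSet_subset (hH ▸ ⟨C, hC, he⟩)
    rw [hCz] at hsub heC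
    have h1 : G.Adj x y := hsub (a := (x, y)) (by simp)
    have h2 : G.Adj y z := hsub (a := (y, z)) (by simp)
    have h3 : G.Adj z x := hsub (a := (z, x)) (by simp)
    have hp : p = x ∨ p = y ∨ p = z := by
      rcases heC with rfl | rfl | rfl <;> simp_all <;> tauto
    rcases hp with rfl | rfl | rfl
    · exact ⟨.refl, .refl⟩
    · exact ⟨.tail (.single h2) h3, .single h1⟩
    · exact ⟨.single h3, .tail (.single h1) h2⟩
  have hall : ∀ v, ReflTransGen G.Adj v x ∧ ReflTransGen G.Adj x v := by
    intro v
    rcases (hU.1 ▸ Set.mem_univ v : v ∈ F.verts ∪ F.compl.verts) with hv | hv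
    · obtain ⟨w, ⟨hvw, hw⟩, -⟩ := hT _ ⟨v, hv, rfl⟩
      exact ⟨(hF.reflTransGen_of_reachable hvw).trans (hub w hw).1,
        (hub w hw).2.trans (hF.reflTransGen_of_reachable hvw.symm)⟩
    · exact hub v hv
  exact fun u v => (hall u).1.trans (hall v).2

/-- In a decomposition into a forest and triangles sharing an arc, every arc `e` is the only arc
leaving some set of vertices, or entering it. -/
lemma exists_cut_of_decomposition {F : SubDigraph G} (hF : F.IsBidirectedForest)
    (hC : F.compl.ConsistsOfTrianglesSharingArc)
    (hT : ∀ T : Set V, F.IsTree T → ∃! w : V, w ∈ T ∧ w ∈ F.compl.verts)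
    {u v : V} (huv : G.Adj u v) :
    ∃ X : Set V, X.Nonempty ∧ Xᶜ.Nonempty ∧
      ∀ p ∈ X, ∀ q ∉ X, G.Adj p q → (p, q) = (u, v) := by
  by_cases he : (u, v) ∈ F.arcSet
  · have hb := SimpleGraph.isAcyclic_iff_forall_adj_isBridge.1 hF.2.2
      (hF.underlying_adj_iff.2 he)
    rw [SimpleGraph.isBridge_iff] at hb
    set K := F.underlying.deleteEdges {s(u, v)} with hK
    have hKF : K ≤ F.underlying := SimpleGraph.deleteEdges_le _
    have hadj : ∀ {p q}, (p, q) ∈ F.arcSet → (p, q) ≠ (u, v) → (p, q) ≠ (v, u) → K.Adj p q := by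
      intro p q hpq h1 h2
      rw [hK, SimpleGraph.deleteEdges_adj]
      refine ⟨hF.underlying_adj_iff.2 hpq, fun h => ?_⟩
      rcases Sym2.eq_iff.1 h with ⟨rfl, rfl⟩ | ⟨rfl, rfl⟩
      exacts [h1 rfl, h2 rfl]
    have huvF := (hF.underlying_adj_iff.2 he).reachable
    -- Deleting the edge splits its tree in two, and at most one half meets `G ∖ F`. The cut
    -- isolates a half that does not: the half of `v` here, that of `u` otherwise.
    by_cases hX : ∃ w, K.Reachable u w ∧ w ∈ F.compl.verts
    · obtain ⟨w, huw, hw⟩ := hX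
      refine ⟨{q | ¬ K.Reachable v q}, ⟨u, fun h => hb h.symm⟩, ⟨v, by simp⟩, ?_⟩
      intro p hp q hq hpq
      simp only [Set.mem_ofPred_eq, not_not] at hp hq
      by_contra hne
      by_cases hpqF : (p, q) ∈ F.arcSet
      · by_cases hne' : (p, q) = (v, u)
        · obtain ⟨rfl, rfl⟩ := Prod.mk.inj hne'
          exact hp .rfl
        · exact hp (hq.trans (hadj hpqF hne hne').reachable.symm)
      · have hqH : q ∈ F.compl.verts := ⟨(p, q), ⟨hpq, hpqF⟩, Or.inr rfl⟩
        have := eq_of_reachable hT hw hqH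
          ((huw.mono hKF).symm.trans (huvF.trans (hq.mono hKF)))
        subst this
        exact hb (huw.trans hq.symm)
    · push Not at hX
      refine ⟨{q | K.Reachable u q}, ⟨u, by simp⟩, ⟨v, hb⟩, ?_⟩
      intro p hp q hq hpq
      simp only [Set.mem_ofPred_eq] at hp hq
      by_contra hne
      by_cases hpqF : (p, q) ∈ F.arcSet
      · by_cases hne' : (p, q) = (v, u)
        · obtain ⟨rfl, rfl⟩ := Prod.mk.inj hne'
          exact hq .rfl
        · exact hq (hp.trans (hadj hpqF hne hne').reachable)
      · exact hX p hp ⟨(p, q), ⟨hpq, hpqF⟩, Or.inl rfl⟩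
  · obtain ⟨⟨x, y⟩, -, 𝒞, -, h𝒞, hH⟩ := hC
    have key : ∀ {p q : V}, (p, q) ∈ F.compl.arcSet → x ≠ y ∧ ((p, q) = (x, y) ∨
        (p = y ∧ q ≠ x ∧ q ≠ y) ∨ (q = x ∧ p ≠ x ∧ p ≠ y)) := by
      intro p q hpq
      obtain ⟨C, hC, heC⟩ : (p, q) ∈ ⋃₀ 𝒞 := hH ▸ hpq
      obtain ⟨z, n1, n2, n3, hCz⟩ := (h𝒞 C hC).1.eq_of_mem (h𝒞 C hC).2
      rw [hCz] at heC
      simp only [Set.mem_insert_iff, Set.mem_singleton_iff, Prod.mk.injEq] at heC ⊢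
      refine ⟨n1, ?_⟩
      rcases heC with ⟨rfl, rfl⟩ | ⟨rfl, rfl⟩ | ⟨rfl, rfl⟩
      · simp
      · exact Or.inr (Or.inl ⟨rfl, n3, n2.symm⟩)
      · exact Or.inr (Or.inr ⟨rfl, n3, n2.symm⟩)
    have huvH : (u, v) ∈ F.compl.arcSet := ⟨huv, he⟩
    have hne : u ≠ v := by have := key huvH; grind
    have hu : u ∈ F.compl.verts := F.compl.fst_mem _ huvH
    have hv : v ∈ F.compl.verts := F.compl.snd_mem _ huvH
    have hcut : ¬ F.underlying.Reachable u v := fun h => hne (eq_of_reachable hT hu hv h)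
    -- In the union of triangles through `(x, y)`, only `x` can have several entering arcs and only
    -- `y` several leaving ones. If `u = y`, the arc is the only one of `G ∖ F` entering `v`, so the
    -- cut is around the tree of `v`. Otherwise it is the only one leaving `u`, so the cut is around
    -- the tree of `u`.
    by_cases hvx : u = y
    · subst hvx
      refine ⟨{q | ¬ F.underlying.Reachable v q}, ⟨u, fun h => hcut h.symm⟩, ⟨v, by simp⟩, ?_⟩
      intro p hp q hq hpq
      simp only [Set.mem_ofPred_eq, not_not] at hp hq
      by_cases hpqF : (p, q) ∈ F.arcSet
      · exact absurd (hq.trans (hF.underlying_adj_iff.2 hpqF).reachable.symm) hp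
      · have hpqH : (p, q) ∈ F.compl.arcSet := ⟨hpq, hpqF⟩
        have := eq_of_reachable hT hv (F.compl.snd_mem _ hpqH) hq
        have h1 := key huvH
        have h2 := key hpqH
        grind
    · refine ⟨{q | F.underlying.Reachable u q}, ⟨u, by simp⟩, ⟨v, hcut⟩, ?_⟩
      intro p hp q hq hpq
      simp only [Set.mem_ofPred_eq] at hp hq
      by_cases hpqF : (p, q) ∈ F.arcSet
      · exact absurd (hp.trans (hF.underlying_adj_iff.2 hpqF).reachable) hq
      · have hpqH : (p, q) ∈ F.compl.arcSet := ⟨hpq, hpqF⟩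
        have := eq_of_reachable hT hu (F.compl.fst_mem _ hpqH) hp
        have h1 := key huvH
        have h2 := key hpqH
        grind

lemma isMinimallyStronglyConnected_of_decomposition [Finite V] {F : SubDigraph G}
    (hF : F.IsBidirectedForest) (hU : F.UnionEq F.compl)
    (hC : F.compl.ConsistsOfTrianglesSharingArc)
    (hT : ∀ T : Set V, F.IsTree T → ∃! w : V, w ∈ T ∧ w ∈ F.compl.verts) :
    G.IsMinimallyStronglyConnected := by
  refine ⟨isStronglyConnected_of_decomposition hF hU hC hT, fun G' hsub hcard hG' => ?_⟩
  obtain ⟨⟨u, v⟩, huv, huv'⟩ : ∃ e ∈ G.arcs, e ∉ G'.arcs := by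
    by_contra! h
    rw [hsub.antisymm h] at hcard
    omega
  obtain ⟨X, ⟨p, hp⟩, ⟨q, hq⟩, hX⟩ := exists_cut_of_decomposition hF hC hT huv
  refine hq ?_
  have := hG' p q
  -- Without the arc from `u` to `v`, a path in `G'` that starts in `X` can never leave `X`.
  clear hq
  induction this with
  | refl => exact hp
  | @tail c d _ hcd ih =>
    by_contra hd
    exact huv' (hX c ih d hd (hsub (a := (c, d)) hcd) ▸ hcd)

end Digraph

theorem mainTheorem7 {V : Type*} [Fintype V] (G : Digraph V) (n : ℕ)
    (hn : Fintype.card V = n) (hm : (G.arcs.ncard : ℤ) = 2 * (n : ℤ) - 3) :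
    G.IsMinimallyStronglyConnected ↔
      ∃ F : G.SubDigraph,
        F.IsBidirectedForest ∧
        F.UnionEq F.compl ∧
        F.compl.ConsistsOfTrianglesSharingArc ∧
        ∀ T : Set V, F.IsTree T → ∃! w : V, w ∈ T ∧ w ∈ F.compl.verts := by
  constructor
  · intro hG
    exact ⟨_, hG.exists_decomposition (by omega)⟩
  · rintro ⟨F, hF, hU, hC, hT⟩
    exact Digraph.isMinimallyStronglyConnected_of_decomposition hF hU hC hT
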